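/- Let $T$ be a complete Heyting algebra (a poset with arbitrary suprema $\Sigma$ and finite infima $\wedge$ such that $b\wedge\Sigma A=\Sigma\{a\wedge b\mid a\in A\}$). Given a set $A$ and a map $\mathrm{Id}:A\times A\to T$, put $\mathsf E x=\mathrm{Id}(x,x)$, and call a function $a:A\to T$ an \emph{atom} if $a(x)\wedge\mathrm{Id}(x,y)\le a(y)$ and $a(x)\wedge a(y)\le\mathrm{Id}(x,y)$ for all $x,y\in A$. A \emph{$T$-set} is a pair $(A,\mathrm{Id})$ such that - $\mathrm{Id}(x,y)=\mathrm{Id}(y,x)$ and $\mathrm{Id}(x,y)\wedge\mathrm{Id}(y,z)\le\mathrm{Id}(x,z)$ for all $x,y,z\in A$; - the relation $x\le y:\Leftrightarrow \mathsf E x=\mathrm{Id}(x,y)$ on $A$ is antisymmetric (equivalently, elements that represent the same atom are equal); - every atom $a$ is real: there is $x\in A$ with $a(y)=\mathrm{Id}(x,y)$ for all $y\in A$. For $x\in A$ and $p\in T$ let $x\restriction p\in A$ be the element that represents the atom $y\mapsto \mathrm{Id}(x,y)\wedge p$. A morphism $(A,\mathrm{Id}_A)\to(B,\mathrm{Id}_B)$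 of $T$-sets is a map $\rho:A\to B$ with $\mathsf E\,\rho(x)=\mathsf E\,x$ and $\rho(x\restriction p)=\rho(x)\restriction p$ for all $x\in A$, $p\in T$. For a $T$-set $A$ and $p\in T$ put $A(p)=\{x\in A\mid \mathsf E x=p\}$; with the restriction maps $x\mapsto x\restriction q$ for $q\le p$ this is a presheaf of sets on the poset $T$, functorial in $A$. **Theorem.** The category of $T$-sets is an elementary topos, that is: 1. it has all finite limits (in particular a terminal object $1$ and pullbacks); 2. for every object $X$ the functor $(-)\times X$ has a right adjoint $(-)^X$; 3. it has a subobject classifier $\mathrm{true}:1\to\Omega$. Moreover, there are bijections $\Omega(p)\cong\{\downarrow s\mid s\le p\}$, where $\downarrow s=\{r\in T\mid r\le s\}$, under which the restriction $\Omega(p)\to\Omega(q)$ for $q\le p$ is $S\mapsto S\cap\downarrow q$ and $\mathrm{true}$ sends the element of $1(p)$ to $\downarrow p$. There is a (contravariant) power functor $P$ with $P X=\Omega^X$ which sends $f:X\to Y$ to the exponential transpose of $\Omega^Y\times X\xrightarrow{1\times f}\Omega^Y\times Y\xrightarrow{\mathrm{ev}}\Omega$. Finally, let $J$ be the Grothendieck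 topology on the poset $T$ with basis $K(p)=\{\Theta\subseteq T\mid\Sigma\Theta=p\}$. Then there is an equivalence from the category of $T$-sets to the category $\mathrm{Sh}(T,J)$ of sheaves of sets whose underlying functor to presheaves is isomorphic to $A\mapsto(p\mapsto A(p))$. -/

import Mathlib

open CategoryTheory CategoryTheory.Limits Opposite

universe v u

/-! ### Sets over a complete Heyting algebra -/

/-- An atom of `(A, δ)`, where `δ : A → A → T`: a function `a : A → T` with
`a x ⊓ δ x y ≤ a y` and `a x ⊓ a y ≤ δ x y`. -/
structure IsTAtom {T : Type u} [Order.Frame T] {A : Type u} (δ : A → A → T) (a : A → T) :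
    Prop where
  extensional : ∀ x y, a x ⊓ δ x y ≤ a y
  singleton : ∀ x y, a x ⊓ a y ≤ δ x y

/-- A `T`-set over the complete Heyting algebra `T`: a set with a symmetric and transitive
`T`-valued identity `δ`, for which the relation `x ≤ y :↔ δ x x = δ x y` is antisymmetric (so that
an element is determined by the atom it represents), and such that every atom is real, that is,
represented by an element. -/
structure TSet (T : Type u) [Order.Frame T] where
  carrier : Type u
  δ : carrier → carrier → T
  symm : ∀ x y, δ x y = δ y x
  trans : ∀ x y z, δ x y ⊓ δ y z ≤ δ x z
  antisymm : ∀ x y, δ x x = δ x y → δ y y = δ y x → x = y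
  real : ∀ a : carrier → T, IsTAtom δ a → ∃ x, ∀ y, a y = δ x y

namespace TSet

variable {T : Type u} [Order.Frame T]

/-- The existence (self-identity) of an element. -/
def ex (A : TSet T) (x : A.carrier) : T := A.δ x x

theorem δ_le_ex_left (A : TSet T) (x y : A.carrier) : A.δ x y ≤ A.ex x := by
  have h := A.trans x y x
  rwa [A.symm y x, inf_idem] at h

theorem eq_of_δ_eq (A : TSet T) {x y : A.carrier} (h : ∀ z, A.δ x z = A.δ y z) : x = y := by
  apply A.antisymm
  · rw [h x, A.symm y x]
  · rw [← h y, A.symm x y]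

/-- The localisation at `p` of the atom represented by `x` is an atom. -/
theorem isTAtom_loc (A : TSet T) (x : A.carrier) (p : T) :
    IsTAtom A.δ (fun y => A.δ x y ⊓ p) where
  extensional y z := by
    have h := A.trans x y z
    exact le_inf (le_trans (inf_le_inf_right _ inf_le_left) h) (inf_le_left.trans inf_le_right)
  singleton y z := by
    have h := A.trans y x z
    rw [A.symm y x] at h
    exact le_trans (inf_le_inf inf_le_left inf_le_left) h

/-- The localisation `x ↾ p`: the element representing the atom `y ↦ δ x y ⊓ p`. -/
noncomputable def loc (A : TSet T) (x : A.carrier) (p : T) : A.carrier :=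
  (A.real _ (A.isTAtom_loc x p)).choose

theorem δ_loc (A : TSet T) (x : A.carrier) (p : T) (y : A.carrier) :
    A.δ (A.loc x p) y = A.δ x y ⊓ p :=
  ((A.real _ (A.isTAtom_loc x p)).choose_spec y).symm

theorem ex_loc (A : TSet T) (x : A.carrier) (p : T) : A.ex (A.loc x p) = A.ex x ⊓ p := by
  unfold ex
  rw [δ_loc, A.symm, δ_loc, inf_assoc, inf_idem]

theorem loc_loc (A : TSet T) (x : A.carrier) (p q : T) :
    A.loc (A.loc x p) q = A.loc x (p ⊓ q) :=
  A.eq_of_δ_eq fun z => by simp only [δ_loc, inf_assoc]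

theorem loc_of_ex_le (A : TSet T) (x : A.carrier) {p : T} (h : A.ex x ≤ p) : A.loc x p = x :=
  A.eq_of_δ_eq fun z => by rw [δ_loc, inf_eq_left.2 ((A.δ_le_ex_left x z).trans h)]

/-- A relation between `T`-sets: a map preserving existence and localisations. -/
@[ext]
structure Hom (A B : TSet T) where
  toFun : A.carrier → B.carrier
  map_ex : ∀ x, B.ex (toFun x) = A.ex x
  map_loc : ∀ x p, toFun (A.loc x p) = B.loc (toFun x) p

instance : Category.{u} (TSet T) where
  Hom A B := Hom A B
  id A := ⟨fun x => x, fun _ => rfl, fun _ _ => rfl⟩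
  comp f g := ⟨fun x => g.toFun (f.toFun x),
    fun x => by rw [g.map_ex, f.map_ex], fun x p => by rw [f.map_loc, g.map_loc]⟩

/-- The set `A(p) = {x ∈ A | ex x = p}` of sections of `A` over `p`. -/
abbrev Sections (A : TSet T) (p : T) : Type u := {x : A.carrier // A.ex x = p}

/-- The restriction `A(p) → A(q)`, `x ↦ x ↾ q`, for `q ≤ p`. -/
noncomputable def restrict (A : TSet T) {p q : T} (h : q ≤ p) (x : A.Sections p) :
    A.Sections q :=
  ⟨A.loc x.1 q, by rw [ex_loc, x.2, inf_eq_right.2 h]⟩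

/-- The map `A(p) → B(p)` induced by a relation `A ⟶ B`. -/
def mapSections {A B : TSet T} (f : A ⟶ B) (p : T) (x : A.Sections p) : B.Sections p :=
  ⟨Hom.toFun f x.1, (Hom.map_ex f x.1).trans x.2⟩

/-- The presheaf `p ↦ A(p)` on the poset `T`. -/
noncomputable def presheaf (A : TSet T) : Tᵒᵖ ⥤ Type u where
  obj p := A.Sections p.unop
  map f := ↾fun x => A.restrict (leOfHom f.unop) x
  map_id p := by
    ext x
    exact A.loc_of_ex_le x.1 x.2.le
  map_comp {p q r} f g := by
    ext x
    change A.loc x.1 r.unop = A.loc (A.loc x.1 q.unop) r.unop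
    rw [loc_loc, inf_eq_right.2 (leOfHom g.unop)]

/-- The functor sending a `T`-set to its presheaf of sections. -/
noncomputable def presheafFunctor (T : Type u) [Order.Frame T] :
    TSet T ⥤ (Tᵒᵖ ⥤ Type u) where
  obj A := A.presheaf
  map {A B} f :=
    { app := fun p => ↾fun x => mapSections f p.unop x
      naturality := fun p q g => by
        ext x
        exact Subtype.ext (Hom.map_loc f x.1 q.unop) }
  map_id A := rfl
  map_comp f g := rfl

end TSet

/-! ### The site of a complete Heyting algebra -/

/-- The basis of a Grothendieck topology on the poset `T` whose covering families of `p` are the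
families `Θ` of elements below `p` with supremum `p`. -/
def territoryBasis (T : Type u) [Order.Frame T] : Pretopology T where
  coverings p := {Θ | sSup {q | ∃ f : q ⟶ p, Θ f} = p}
  has_isos p q f _ := by
    refine le_antisymm (sSup_le ?_) ?_
    · rintro r ⟨g, -⟩
      exact leOfHom g
    · exact (leOfHom (inv f)).trans (le_sSup ⟨f, Presieve.singleton_self f⟩)
  pullbacks p r f Θ hΘ := by
    refine le_antisymm (sSup_le ?_) ?_
    · rintro s ⟨g, -⟩
      exact leOfHom g
    · have h : r = r ⊓ sSup {q | ∃ f : q ⟶ p, Θ f} := by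
        rw [show sSup {q | ∃ f : q ⟶ p, Θ f} = p from hΘ, inf_eq_left.2 (leOfHom f)]
      refine h.le.trans ?_
      rw [inf_sSup_eq]
      refine iSup₂_le fun q hq => ?_
      obtain ⟨g, hg⟩ := hq
      have hle : r ⊓ q ≤ pullback g f :=
        leOfHom (pullback.lift (homOfLE inf_le_right) (homOfLE inf_le_left) rfl)
      exact hle.trans (le_sSup ⟨_, Presieve.pullbackArrows.mk _ _ hg⟩)
  transitive p Θ Ξ hΘ hΞ := by
    refine le_antisymm (sSup_le ?_) ?_
    · rintro s ⟨g, -⟩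
      exact leOfHom g
    · conv_lhs => rw [← show sSup {q | ∃ f : q ⟶ p, Θ f} = p from hΘ]
      refine sSup_le ?_
      rintro q ⟨f, hf⟩
      conv_lhs => rw [← show sSup {s | ∃ g : s ⟶ q, Ξ f hf g} = q from hΞ f hf]
      refine sSup_le ?_
      rintro s ⟨g, hg⟩
      exact le_sSup ⟨g ≫ f, ⟨q, g, f, hf, hg, rfl⟩⟩

/-- The Grothendieck topology on `T` generated by the basis of families with `⋁ Θ = p`. -/
def territoryTopology (T : Type u) [Order.Frame T] : GrothendieckTopology T :=
  (territoryBasis T).toGrothendieck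

/-! ### Elementary toposes -/

/-- An elementary topos: a category with finite limits, in which every functor `(-) × X` has a
right adjoint, and which has a subobject classifier. -/
class IsElementaryTopos (E : Type u) [Category.{v} E] : Prop extends HasFiniteLimits E where
  exponentials : ∀ X : E, (prod.functor.flip.obj X).IsLeftAdjoint
  classifier : HasSubobjectClassifier E

/-- The power functor `P : Eᵒᵖ ⥤ E` of an object `Ω`: `P X` is the exponential `Ω ^ X`, with
evaluation `ev X : P X × X ⟶ Ω`, and for `f : X ⟶ Y` the arrow `P f : P Y ⟶ P X` is the
exponential transpose of the composite of `1 × f : P Y × X ⟶ P Y × Y` and `ev Y`. -/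
structure PowerFunctor {E : Type u} [Category.{v} E] [HasBinaryProducts E] (Ω : E) where
  P : Eᵒᵖ ⥤ E
  ev : ∀ X : E, P.obj (op X) ⨯ X ⟶ Ω
  transpose : ∀ (X Z : E) (g : Z ⨯ X ⟶ Ω),
    ∃! h : Z ⟶ P.obj (op X), prod.map h (𝟙 X) ≫ ev X = g
  map_ev : ∀ {X Y : E} (f : X ⟶ Y),
    prod.map (P.map f.op) (𝟙 X) ≫ ev X = prod.map (𝟙 (P.obj (op Y))) f ≫ ev Y

/-- The subobject classifier `c` of the category of `T`-sets is given by principal down-sets: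
there are bijections of `Ω(p)` with `{↓s | s ≤ p}`, under which restriction to `q ≤ p` is
intersection with `↓q`, and the arrow `true` sends the section of `1` over `p` to `↓p`. -/
def IsDownSetClassifier {T : Type u} [Order.Frame T] (c : Subobject.Classifier (TSet T)) : Prop :=
  ∃ e : ∀ p : T, c.Ω.Sections p ≃ {S : Set T // ∃ s ≤ p, S = Set.Iic s},
    (∀ (p q : T) (h : q ≤ p) (x : c.Ω.Sections p),
      (e q (c.Ω.restrict h x)).1 = (e p x).1 ∩ Set.Iic q) ∧
    ∀ (p : T) (z : c.Ω₀.Sections p), (e p (TSet.mapSections c.truth p z)).1 = Set.Iic p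

/-! ### Power functors -/

section PowerFunctor

variable {E : Type u} [Category.{v} E] [HasBinaryProducts E]

/-! A `T`-set is a sheaf on `T` with its sections pooled into one set, `Id x y` being the largest
extent on which `x` and `y` agree. The axiom that atoms are real is then the gluing axiom: a
compatible family has as pointwise supremum an atom, whose representative glues it (`exists_glue`),
while distributivity gives separatedness (`eq_of_loc_eq`). Conversely, in the set of all sections of
a sheaf, an atom `a` is a compatible family, namely each `x` cut down to `a x`, and its gluing
represents `a` (`sectionId_real`).

So sections give a fully faithful, essentially surjective functor to sheaves. The topos structure is
transported along it. The classifier for sheaves consists of closed sieves, which on a frame are the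
principal down-sets (`Sieve.isClosed_territoryTopology_iff`). -/

theorem CategoryTheory.Adjunction.existsUnique_prod_map_counit {X : E} {R : E ⥤ E}
    (adj : prod.functor.flip.obj X ⊣ R) (Ω Z : E) (g : Z ⨯ X ⟶ Ω) :
    ∃! h : Z ⟶ R.obj Ω, prod.map h (𝟙 X) ≫ adj.counit.app Ω = g := by
  refine ⟨adj.homEquiv Z Ω g, ?_, fun h hh => ?_⟩
  · exact (adj.homEquiv_counit (g := adj.homEquiv Z Ω g)).symm.trans
      ((adj.homEquiv Z Ω).symm_apply_apply g)
  · rw [← hh]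
    exact ((adj.homEquiv Z Ω).apply_symm_apply h).symm.trans
      (congrArg _ (adj.homEquiv_counit (g := h)))

/-- Evaluation maps with the universal property of exponentials assemble into a power functor. -/
theorem PowerFunctor.nonempty_of_transpose (Ω : E) (Q : E → E) (ev : ∀ X : E, Q X ⨯ X ⟶ Ω)
    (transpose : ∀ (X Z : E) (g : Z ⨯ X ⟶ Ω),
      ∃! h : Z ⟶ Q X, prod.map h (𝟙 X) ≫ ev X = g) :
    Nonempty (PowerFunctor Ω) := by
  -- The action on arrows is forced by the transpose condition; its uniqueness part `hu` yields
  -- functoriality.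
  choose m hm hu using fun (X Y : E) (f : X ⟶ Y) =>
    transpose X (Q Y) (prod.map (𝟙 (Q Y)) f ≫ ev Y)
  dsimp only at hm hu
  refine ⟨⟨{
    obj := fun X => Q X.unop
    map := fun f => m _ _ f.unop
    map_id := ?_
    map_comp := ?_ }, ev, transpose, fun f => hm _ _ f⟩⟩
  · intro X
    exact (hu _ _ _ _ (by simp)).symm
  · intro X Y Z f g
    refine (hu _ _ _ _ ?_).symm
    have h : prod.map (m _ _ f.unop ≫ m _ _ g.unop) (𝟙 Z.unop) =
        prod.map (m _ _ f.unop) (𝟙 Z.unop) ≫ prod.map (m _ _ g.unop) (𝟙 Z.unop) := by simp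
    rw [h, Category.assoc, hm, ← Category.assoc, prod.map_map, Category.comp_id, Category.id_comp]
    have h' : prod.map (m _ _ f.unop) g.unop =
        prod.map (𝟙 _) g.unop ≫ prod.map (m _ _ f.unop) (𝟙 _) := by simp
    rw [h', Category.assoc, hm, ← Category.assoc, prod.map_map, Category.id_comp]
    rfl

theorem IsElementaryTopos.nonempty_powerFunctor {E : Type u} [Category.{v} E]
    [IsElementaryTopos E] (Ω : E) : Nonempty (PowerFunctor Ω) := by
  choose R h using fun X : E => (IsElementaryTopos.exponentials X).exists_rightAdjoint
  exact PowerFunctor.nonempty_of_transpose Ω (fun X => (R X).obj Ω)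
    (fun X => (h X).some.counit.app Ω)
    fun X Z g => (h X).some.existsUnique_prod_map_counit Ω Z g

end PowerFunctor

/-! ### Transport of the topos structure from sheaves. -/

theorem IsElementaryTopos.of_equivalence_sheaf {C : Type u} [SmallCategory C]
    (J : GrothendieckTopology C) {E : Type v} [Category.{u} E] (e : E ≌ Sheaf J (Type u)) :
    IsElementaryTopos E := by
  have hlim : HasFiniteLimits E :=
    ⟨fun K _ _ => Adjunction.hasLimitsOfShape_of_equivalence (J := K) e.functor⟩
  let : CartesianMonoidalCategory E := .ofHasFiniteProducts
  let : MonoidalClosed (Cᵒᵖ ⥤ Type u) := inferInstance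
  let : MonoidalClosed E := @cartesianClosedOfEquiv _ _ _ _ _ _ e.symm
    (instMonoidalClosedSheafOfHasSheafifyOfFunctorOpposite J (Type u))
  exact {
    -- Closedness provides a right adjoint to `X × (-)`; the braiding turns it into one for `(-) ×
    -- X`.
    exponentials := fun X => Functor.isLeftAdjoint_of_iso
      (F := prod.functor.obj X)
      (NatIso.ofComponents (fun Y => prod.braiding X Y) fun f => by
        simp [prod.functor])
    classifier := ⟨⟨(Sheaf.classifier J).ofEquivalence e.symm⟩⟩ }

/-! ### Sheaves on a complete Heyting algebra -/

section Territory

variable {T : Type u} [Order.Frame T]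

theorem territoryTopology_mem_iff {p : T} (S : Sieve p) :
    S ∈ territoryTopology T p ↔ sSup {q | ∃ f : q ⟶ p, S f} = p := by
  refine ((territoryBasis T).mem_toGrothendieck p S).trans ⟨?_, fun h => ⟨S.arrows, h, le_rfl⟩⟩
  rintro ⟨R, hR, hRS⟩
  refine le_antisymm (sSup_le fun q hq => leOfHom hq.choose) ?_
  conv_lhs => rw [← show sSup {q | ∃ f : q ⟶ p, R f} = p from hR]
  exact sSup_le_sSup fun q ⟨f, hf⟩ => ⟨f, hRS _ _ hf⟩

theorem isSheaf_territoryTopology_iff (F : Tᵒᵖ ⥤ Type u) :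
    Presieve.IsSheaf (territoryTopology T) F ↔
      ∀ {p : T} (S : Sieve p), sSup {q | ∃ f : q ⟶ p, S f} = p →
        Presieve.IsSheafFor F S.arrows :=
  ⟨fun h _ S hS => h S ((territoryTopology_mem_iff S).2 hS),
    fun h _ S hS => h S ((territoryTopology_mem_iff S).1 hS)⟩

end Territory

namespace TSet

variable {T : Type u} [Order.Frame T]

/-! ### The sheaf of sections of a `T`-set -/

/-- Turns an inequality on identities, `t` agreeing with `x` wherever `x` exists, into an equation
of restrictions. -/
theorem loc_ex_eq_of_le (A : TSet T) {x t : A.carrier} (h : A.ex x ≤ A.δ t x) :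
    A.loc t (A.ex x) = x := by
  refine A.eq_of_δ_eq fun y => ?_
  rw [δ_loc]
  refine le_antisymm ?_ (le_inf ?_ (A.δ_le_ex_left x y))
  · refine le_trans (le_inf (inf_le_right.trans h) inf_le_left) ?_
    rw [A.symm t x]
    exact A.trans x t y
  · exact le_trans (le_inf ((A.δ_le_ex_left x y).trans h) le_rfl) (A.trans t x y)

theorem loc_inf_ex (A : TSet T) (x : A.carrier) (p : T) : A.loc x (A.ex x ⊓ p) = A.loc x p := by
  rw [← loc_loc, A.loc_of_ex_le x le_rfl]

/-- The supremum of the atoms represented by a pairwise compatible family is an atom. -/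
theorem isTAtom_iSup (A : TSet T) {ι : Type*} (x : ι → A.carrier)
    (hx : ∀ i j, A.loc (x i) (A.ex (x i) ⊓ A.ex (x j)) = A.loc (x j) (A.ex (x i) ⊓ A.ex (x j))) :
    IsTAtom A.δ (fun y => ⨆ i, A.δ (x i) y) where
  extensional y z := by
    rw [iSup_inf_eq]
    exact iSup_mono fun i => A.trans _ _ _
  singleton y z := by
    rw [iSup_inf_eq]
    refine iSup_le fun i => ?_
    rw [inf_iSup_eq]
    refine iSup_le fun j => ?_
    have hle : A.δ (x i) y ⊓ A.δ (x j) z ≤ A.ex (x i) ⊓ A.ex (x j) :=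
      inf_le_inf (A.δ_le_ex_left _ _) (A.δ_le_ex_left _ _)
    -- On the common extent of `x i` and `x j`, compatibility lets `x j` replace `x i`.
    have h : A.δ (x i) y ⊓ A.δ (x j) z ≤ A.δ (x j) y := by
      refine le_trans (le_inf inf_le_left hle) ?_
      rw [← δ_loc, hx, δ_loc]
      exact inf_le_left
    refine (le_inf h inf_le_right).trans ?_
    rw [A.symm (x j) y]
    exact A.trans _ _ _

theorem exists_glue (A : TSet T) {ι : Type*} (x : ι → A.carrier)
    (hx : ∀ i j, A.loc (x i) (A.ex (x i) ⊓ A.ex (x j)) = A.loc (x j) (A.ex (x i) ⊓ A.ex (x j))) :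
    ∃ t, A.ex t = ⨆ i, A.ex (x i) ∧ ∀ i, A.loc t (A.ex (x i)) = x i := by
  obtain ⟨t, ht⟩ := A.real _ (A.isTAtom_iSup x hx)
  have hle : ∀ i, A.ex (x i) ≤ A.δ t (x i) := fun i => by
    rw [← ht]
    exact le_iSup (fun j => A.δ (x j) (x i)) i
  refine ⟨t, le_antisymm ?_ (iSup_le fun i => (hle i).trans (A.δ_le_ex_left _ _)),
    fun i => A.loc_ex_eq_of_le (hle i)⟩
  rw [ex, ← ht]
  exact iSup_mono fun i => A.δ_le_ex_left _ _

theorem eq_of_loc_eq (A : TSet T) {x y : A.carrier} {Θ : Set T} (hx : A.ex x ≤ sSup Θ)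
    (hy : A.ex y ≤ sSup Θ) (h : ∀ q ∈ Θ, A.loc x q = A.loc y q) : x = y := by
  refine A.eq_of_δ_eq fun z => ?_
  rw [← inf_eq_left.2 ((A.δ_le_ex_left x z).trans hx),
    ← inf_eq_left.2 ((A.δ_le_ex_left y z).trans hy), inf_sSup_eq, inf_sSup_eq]
  refine iSup_congr fun q => iSup_congr fun hq => ?_
  rw [← δ_loc, h q hq, δ_loc]

theorem isSheaf_presheaf (A : TSet T) : Presieve.IsSheaf (territoryTopology T) A.presheaf := by
  refine (isSheaf_territoryTopology_iff _).2 fun {p} S hS => ?_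
  intro s hs
  have hex : ∀ i : (q : T) × {f : q ⟶ p // S f}, A.ex (s i.2.1 i.2.2).1 = i.1 :=
    fun i => (s i.2.1 i.2.2).2
  obtain ⟨t, ht, htx⟩ := A.exists_glue
    (fun i : (q : T) × {f : q ⟶ p // S f} => (s i.2.1 i.2.2).1) (by
      intro i j
      simp only [hex]
      exact congrArg Subtype.val (hs (homOfLE inf_le_left : i.1 ⊓ j.1 ⟶ i.1)
        (homOfLE inf_le_right : i.1 ⊓ j.1 ⟶ j.1) i.2.2 j.2.2 (Subsingleton.elim _ _)))
  simp only [hex] at ht htx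
  have htp : A.ex t = p := by
    refine ht.trans (le_antisymm (iSup_le fun i => leOfHom i.2.1) (hS.ge.trans (sSup_le ?_)))
    rintro q ⟨f, hf⟩
    exact le_iSup (fun i : (q : T) × {f : q ⟶ p // S f} => i.1) ⟨q, f, hf⟩
  refine ⟨⟨t, htp⟩, fun q f hf => Subtype.ext (htx ⟨q, f, hf⟩), ?_⟩
  rintro ⟨y, hy⟩ hyx
  refine Subtype.ext (A.eq_of_loc_eq (hy.trans hS.symm).le (htp.trans hS.symm).le ?_)
  rintro q ⟨f, hf⟩
  exact (congrArg Subtype.val (hyx f hf)).trans (htx ⟨q, f, hf⟩).symm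

/-- The functor sending a `T`-set to its sheaf of sections. -/
noncomputable def sheafFunctor (T : Type u) [Order.Frame T] :
    TSet T ⥤ Sheaf (territoryTopology T) (Type u) :=
  ObjectProperty.lift _ (presheafFunctor T) fun A =>
    (isSheaf_iff_isSheaf_of_type _ _).2 A.isSheaf_presheaf

/-- The map of `T`-sets induced by a map of the presheaves of sections. -/
def homOfPresheafHom {A B : TSet T} (α : A.presheaf ⟶ B.presheaf) : A ⟶ B :=
  Hom.mk (A := A) (B := B) (fun x => (α.app (op (A.ex x)) ⟨x, rfl⟩).1)
    (fun x => (α.app (op (A.ex x)) ⟨x, rfl⟩).2) (fun x p => by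
      -- The extent of a section over `q` equals `q` only propositionally; `key` changes the index
      -- of `α` accordingly.
      have key : ∀ (q : T) (s : A.Sections q),
          (α.app (op (A.ex s.1)) ⟨s.1, rfl⟩).1 = (α.app (op q) s).1 := by
        rintro _ ⟨x, rfl⟩
        rfl
      have h : A.ex x ⊓ p ≤ A.ex x := inf_le_left
      have hnat := congrArg Subtype.val
        (NatTrans.naturality_apply α (homOfLE h).op (⟨x, rfl⟩ : A.Sections (A.ex x)))
      have hx := key _ (A.restrict h ⟨x, rfl⟩)
      have hex : B.ex (α.app (op (A.ex x)) ⟨x, rfl⟩).1 = A.ex x :=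
        (α.app (op (A.ex x)) ⟨x, rfl⟩).2
      -- Naturality only concerns restriction to elements below `A.ex x`, so `p` is replaced by its
      -- meet with it.
      have e : A.loc x (A.ex x ⊓ p) = A.loc x p := A.loc_inf_ex x p
      have e' := B.loc_inf_ex (α.app (op (A.ex x)) ⟨x, rfl⟩).1 p
      rw [hex] at e'
      rw [← e, ← e']
      exact hx.trans hnat)

/-- The functor of sections is fully faithful. -/
def presheafFunctorFullyFaithful (T : Type u) [Order.Frame T] :
    (presheafFunctor T).FullyFaithful where
  preimage α := homOfPresheafHom α
  map_preimage α := by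
    ext p ⟨x, hx⟩
    obtain ⟨p⟩ := p
    change T at p
    change _ = p at hx
    subst hx
    rfl
  preimage_map f := rfl

instance : (presheafFunctor T).Full := (presheafFunctorFullyFaithful T).full

instance : (presheafFunctor T).Faithful := (presheafFunctorFullyFaithful T).faithful

instance : (sheafFunctor T).Full := inferInstanceAs (ObjectProperty.lift _ _ _).Full

instance : (sheafFunctor T).Faithful := inferInstanceAs (ObjectProperty.lift _ _ _).Faithful

end TSet

/-! ### The `T`-set of a sheaf -/

section SheafToTSet

variable {T : Type u} [Order.Frame T] {G : Tᵒᵖ ⥤ Type u}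

/-- Restriction of the sections of a presheaf on `T`. -/
def presheafRes (G : Tᵒᵖ ⥤ Type u) {p q : T} (h : q ≤ p) (x : G.obj (op p)) : G.obj (op q) :=
  G.map (homOfLE h).op x

theorem presheafRes_self {p : T} (h : p ≤ p) (x : G.obj (op p)) : presheafRes G h x = x :=
  Functor.map_id_apply G (op p) x

theorem presheafRes_res {p q r : T} (h : q ≤ p) (k : r ≤ q) (x : G.obj (op p)) :
    presheafRes G k (presheafRes G h x) = presheafRes G (k.trans h) x :=
  (G.map_comp_apply (homOfLE h).op (homOfLE k).op x).symm

theorem isSheafFor_ofArrows_of_iSup (hG : Presieve.IsSheaf (territoryTopology T) G)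
    {ι : Type u} {p : T} (q : ι → T) (hq : ∀ i, q i ≤ p) (hp : p ≤ ⨆ i, q i) :
    (Presieve.ofArrows q fun i => homOfLE (hq i)).IsSheafFor G := by
  rw [Presieve.isSheafFor_iff_generate]
  refine (isSheaf_territoryTopology_iff G).1 hG _ (le_antisymm ?_ (hp.trans ?_))
  · exact sSup_le fun r hr => leOfHom hr.choose
  · exact iSup_le fun i => le_sSup ⟨homOfLE (hq i), Sieve.le_generate _ _ _ (Presieve.ofArrows.mk i)⟩

theorem presheafRes_ext (hG : Presieve.IsSheaf (territoryTopology T) G) {p : T} {Θ : Set T}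
    (hp : p ≤ sSup Θ) {x y : G.obj (op p)}
    (h : ∀ q ∈ Θ, ∀ r (hr : r ≤ p), r ≤ q → presheafRes G hr x = presheafRes G hr y) : x = y := by
  -- Members of `Θ` need not lie below `p`; their meets with `p` do, and still cover it by
  -- distributivity.
  have hs := isSheafFor_ofArrows_of_iSup hG (p := p) (fun q : Θ => p ⊓ q.1)
    (fun q => inf_le_left) (by rw [← inf_iSup_eq, ← sSup_eq_iSup', inf_eq_left.2 hp])
  refine hs.isSeparatedFor.ext ?_
  rintro r f ⟨q⟩
  exact h _ q.2 _ inf_le_left inf_le_right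

theorem exists_presheafRes_eq (hG : Presieve.IsSheaf (territoryTopology T) G) {ι : Type u}
    (q : ι → T) (x : ∀ i, G.obj (op (q i)))
    (hx : ∀ i j r (hi : r ≤ q i) (hj : r ≤ q j),
      presheafRes G hi (x i) = presheafRes G hj (x j)) :
    ∃ z : G.obj (op (⨆ i, q i)), ∀ i, presheafRes G (le_iSup q i) z = x i := by
  have hs := isSheafFor_ofArrows_of_iSup hG q (le_iSup q) le_rfl
  rw [Presieve.isSheafFor_arrows_iff] at hs
  obtain ⟨z, hz, -⟩ := hs x fun i j r f g _ => hx i j r (leOfHom f) (leOfHom g)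
  exact ⟨z, hz⟩

variable (G) in
/-- The extent to which two sections of a presheaf on `T` agree. -/
def sectionId (x y : (p : T) × G.obj (op p)) : T :=
  sSup {r | ∃ (hx : r ≤ x.1) (hy : r ≤ y.1), presheafRes G hx x.2 = presheafRes G hy y.2}

theorem sectionId_le_left (x y : (p : T) × G.obj (op p)) : sectionId G x y ≤ x.1 :=
  sSup_le fun _ h => h.1

theorem sectionId_symm (x y : (p : T) × G.obj (op p)) : sectionId G x y = sectionId G y x :=
  congrArg sSup (Set.ext fun _ => ⟨fun ⟨a, b, h⟩ => ⟨b, a, h.symm⟩, fun ⟨a, b, h⟩ => ⟨b, a, h.symm⟩⟩)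

theorem sectionId_self (x : (p : T) × G.obj (op p)) : sectionId G x x = x.1 :=
  le_antisymm (sectionId_le_left x x) (le_sSup ⟨le_rfl, le_rfl, rfl⟩)

/-- Separatedness makes the supremum defining `sectionId` attained: sections agreeing on a cover of
`r` agree on `r`. -/
theorem le_sectionId_iff (hG : Presieve.IsSheaf (territoryTopology T) G)
    {x y : (p : T) × G.obj (op p)} {r : T} :
    r ≤ sectionId G x y ↔
      ∃ (hx : r ≤ x.1) (hy : r ≤ y.1), presheafRes G hx x.2 = presheafRes G hy y.2 := by
  refine ⟨fun h => ?_, fun h => le_sSup h⟩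
  refine ⟨h.trans (sectionId_le_left x y),
    h.trans ((sectionId_symm x y).le.trans (sectionId_le_left y x)), presheafRes_ext hG h ?_⟩
  rintro q ⟨hx, hy, e⟩ s hs hsq
  rw [presheafRes_res, presheafRes_res]
  have := congrArg (presheafRes G hsq) e
  rwa [presheafRes_res, presheafRes_res] at this

theorem sectionId_trans (hG : Presieve.IsSheaf (territoryTopology T) G)
    (x y z : (p : T) × G.obj (op p)) : sectionId G x y ⊓ sectionId G y z ≤ sectionId G x z := by
  obtain ⟨hx, _, e⟩ := (le_sectionId_iff hG).1
    (inf_le_left : sectionId G x y ⊓ sectionId G y z ≤ sectionId G x y)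
  obtain ⟨_, hz, e'⟩ := (le_sectionId_iff hG).1
    (inf_le_right : sectionId G x y ⊓ sectionId G y z ≤ sectionId G y z)
  exact (le_sectionId_iff hG).2 ⟨hx, hz, e.trans e'⟩

theorem sectionId_real (hG : Presieve.IsSheaf (territoryTopology T) G)
    {a : (p : T) × G.obj (op p) → T} (ha : IsTAtom (sectionId G) a) :
    ∃ x, ∀ y, a y = sectionId G x y := by
  have hle : ∀ x, a x ≤ x.1 := fun x => by
    have h := ha.singleton x x
    rw [inf_idem] at h
    exact h.trans (sectionId_le_left x x)
  obtain ⟨z, hz⟩ := exists_presheafRes_eq hG a (fun x => presheafRes G (hle x) x.2) (by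
    intro x y r hx hy
    obtain ⟨_, _, e⟩ := (le_sectionId_iff hG).1 ((le_inf hx hy).trans (ha.singleton x y))
    rw [presheafRes_res, presheafRes_res]
    exact e)
  have hza : ∀ y, a y ≤ sectionId G ⟨_, z⟩ y := fun y =>
    (le_sectionId_iff hG).2 ⟨le_iSup a y, hle y, hz y⟩
  refine ⟨⟨_, z⟩, fun y => le_antisymm (hza y) ?_⟩
  -- The extent of `z` is the supremum of all `a x`. On the piece `a x`, `z` agrees with `x`, so
  -- extensionality of `a` bounds that piece by `a y`.
  rw [← inf_eq_left.2 (sectionId_le_left ⟨_, z⟩ y), inf_iSup_eq]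
  refine iSup_le fun x => ?_
  have h : sectionId G ⟨_, z⟩ y ⊓ a x ≤ sectionId G x y := by
    refine le_trans (le_inf (inf_le_right.trans (hza x)) inf_le_left) ?_
    rw [sectionId_symm _ x]
    exact sectionId_trans hG _ _ _
  exact le_trans (le_inf inf_le_right h) (ha.extensional x y)

/-- The `T`-set of all sections of a sheaf. -/
def TSet.ofSheaf (G : Tᵒᵖ ⥤ Type u) (hG : Presieve.IsSheaf (territoryTopology T) G) : TSet T where
  carrier := (p : T) × G.obj (op p)
  δ := sectionId G
  symm := sectionId_symm
  trans := sectionId_trans hG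
  antisymm := by
    rintro ⟨p, x⟩ ⟨q, y⟩ hx hy
    rw [sectionId_self] at hx hy
    obtain ⟨_, hpq, e⟩ := (le_sectionId_iff hG).1 hx.le
    obtain ⟨_, hqp, _⟩ := (le_sectionId_iff hG).1 hy.le
    obtain rfl : p = q := le_antisymm hpq hqp
    rw [presheafRes_self, presheafRes_self] at e
    rw [show x = y from e]
  real _ := sectionId_real hG

variable (hG : Presieve.IsSheaf (territoryTopology T) G)

theorem TSet.ex_ofSheaf (x : (TSet.ofSheaf G hG).carrier) : (TSet.ofSheaf G hG).ex x = x.1 :=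
  sectionId_self x

theorem TSet.loc_ofSheaf {p q : T} (h : q ≤ p) (x : G.obj (op p)) :
    (TSet.ofSheaf G hG).loc ⟨p, x⟩ q = ⟨q, presheafRes G h x⟩ := by
  have e := TSet.loc_ex_eq_of_le (TSet.ofSheaf G hG) (t := ⟨p, x⟩) (x := ⟨q, presheafRes G h x⟩)
    ((le_sectionId_iff hG).2 ⟨(TSet.ex_ofSheaf hG _).le.trans h, (TSet.ex_ofSheaf hG _).le, by
      rw [presheafRes_res]⟩)
  have hq : (TSet.ofSheaf G hG).ex ⟨q, presheafRes G h x⟩ = q := TSet.ex_ofSheaf hG _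
  rwa [hq] at e

/-- The sections of the `T`-set of a sheaf are the sections of the sheaf. -/
def TSet.sectionsOfSheafEquiv (p : T) : G.obj (op p) ≃ (TSet.ofSheaf G hG).Sections p where
  toFun x := ⟨⟨p, x⟩, TSet.ex_ofSheaf hG _⟩
  invFun s := presheafRes G (s.2.symm.trans (TSet.ex_ofSheaf hG s.1)).le s.1.2
  left_inv x := presheafRes_self _ x
  right_inv := by
    rintro ⟨⟨q, x⟩, h⟩
    obtain rfl : q = p := (TSet.ex_ofSheaf hG ⟨q, x⟩).symm.trans h
    exact Subtype.ext (congrArg (Sigma.mk q) (presheafRes_self _ x))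

/-- A sheaf is the sheaf of sections of its `T`-set. -/
noncomputable def TSet.presheafOfSheafIso : G ≅ (TSet.ofSheaf G hG).presheaf :=
  NatIso.ofComponents (fun p => (TSet.sectionsOfSheafEquiv hG p.unop).toIso) fun {p q} f => by
    ext x
    exact Subtype.ext (TSet.loc_ofSheaf hG (leOfHom f.unop) x).symm

instance : (TSet.sheafFunctor T).EssSurj where
  mem_essImage F := ⟨TSet.ofSheaf F.obj ((isSheaf_iff_isSheaf_of_type _ _).1 F.property),
    ⟨((sheafToPresheaf _ _).preimageIso (TSet.presheafOfSheafIso _)).symm⟩⟩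

instance : (TSet.sheafFunctor T).IsEquivalence where

/-- The equivalence of `T`-sets and sheaves on `T`. -/
noncomputable def TSet.sheafEquivalence (T : Type u) [Order.Frame T] :
    TSet T ≌ Sheaf (territoryTopology T) (Type u) :=
  (TSet.sheafFunctor T).asEquivalence

end SheafToTSet

/-! ### Closed sieves on a complete Heyting algebra -/

section ClosedSieves

variable {T : Type u} [Order.Frame T]

/-- The generator `s` is the supremum of the sieve: any `q ≤ s` is covered by its meets with members
of the sieve, so closedness puts `q` in it. -/
theorem Sieve.isClosed_territoryTopology_iff {p : T} (S : Sieve p) :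
    (territoryTopology T).IsClosed S ↔ ∃ s ≤ p, {q | ∃ f : q ⟶ p, S f} = Set.Iic s := by
  constructor
  · intro h
    refine ⟨sSup {q | ∃ f : q ⟶ p, S f}, sSup_le fun q hq => leOfHom hq.choose,
      Set.ext fun q => ⟨fun hq => le_sSup hq, fun hq => ?_⟩⟩
    have hqp : q ≤ p := le_trans hq (sSup_le fun q hq => leOfHom hq.choose)
    refine ⟨homOfLE hqp, h _ ((territoryTopology_mem_iff _).2 ?_)⟩
    refine le_antisymm (sSup_le fun r hr => leOfHom hr.choose) ?_
    refine (inf_eq_left.2 hq).ge.trans ?_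
    rw [inf_sSup_eq]
    refine iSup₂_le fun r hr => le_sSup ⟨homOfLE inf_le_left, ?_⟩
    exact S.downward_closed hr.choose_spec (homOfLE inf_le_right)
  · rintro ⟨s, hs, h⟩ q f hf
    have hqs : q ≤ s := by
      rw [← show sSup _ = q from (territoryTopology_mem_iff _).1 hf]
      refine sSup_le ?_
      rintro r ⟨g, hg⟩
      exact h.le ⟨_, hg⟩
    obtain ⟨g, hg⟩ := h.ge hqs
    rwa [Subsingleton.elim f g]

/-- Closed sieves on `p` are the principal down-sets below `p`. -/
def closedSievesEquiv (p : T) :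
    (Functor.closedSieves (territoryTopology T)).toFunctor.obj (op p) ≃
      {S : Set T // ∃ s ≤ p, S = Set.Iic s} where
  toFun S := ⟨{q | ∃ f : q ⟶ p, Sieve.arrows (X := p) S.1 f}, (Sieve.isClosed_territoryTopology_iff S.1).1 S.2⟩
  invFun D := ⟨(⟨fun q _ => q ∈ D.1, fun {q r _} h g => by
      obtain ⟨_, s, _, rfl⟩ := D
      exact (leOfHom g).trans h⟩ : Sieve p), (Sieve.isClosed_territoryTopology_iff _).2 (by
      obtain ⟨_, s, hs, rfl⟩ := D
      exact ⟨s, hs, Set.ext fun q => ⟨fun ⟨_, h⟩ => h, fun h => ⟨homOfLE (le_trans h hs), h⟩⟩⟩)⟩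
  left_inv := fun ⟨(S : Sieve p), _⟩ => Subtype.ext (Sieve.ext fun q f =>
    ⟨fun ⟨g, hg⟩ => Subsingleton.elim g f ▸ hg, fun h => ⟨f, h⟩⟩)
  right_inv := by
    rintro ⟨_, s, hs, rfl⟩
    exact Subtype.ext (Set.ext fun q => ⟨fun ⟨_, h⟩ => h, fun h => ⟨homOfLE (le_trans h hs), h⟩⟩)

end ClosedSieves

/-- The classifier of the sheaf topos, transported to `T`-sets, is given by down-sets. -/
theorem TSet.isDownSetClassifier_ofEquivalence (T : Type u) [Order.Frame T] :
    IsDownSetClassifier ((Sheaf.classifier (territoryTopology T)).ofEquivalence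
      (TSet.sheafEquivalence T).symm) := by
  let J := territoryTopology T
  -- The counit identifies the sections of the `T`-set attached to `F` with those of `F`; its
  -- naturality carries restriction and `true` over to closed sieves.
  let ε : ∀ F : Sheaf J (Type u), ((TSet.sheafEquivalence T).inverse.obj F).presheaf ≅ F.obj :=
    fun F => (sheafToPresheaf J _).mapIso ((TSet.sheafEquivalence T).counitIso.app F)
  have hnat : ∀ {F G : Sheaf J (Type u)} (f : F ⟶ G),
      (TSet.presheafFunctor T).map ((TSet.sheafEquivalence T).inverse.map f) ≫ (ε G).hom =
        (ε F).hom ≫ f.hom := fun f =>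
    congrArg (sheafToPresheaf J _).map ((TSet.sheafEquivalence T).counitIso.hom.naturality f)
  refine ⟨fun p => ((ε (Sheaf.Ω J)).app (op p)).toEquiv.trans (closedSievesEquiv p), ?_, ?_⟩
  · intro p q h x
    have hx := NatTrans.naturality_apply (ε (Sheaf.Ω J)).hom (homOfLE h).op x
    refine (congrArg (fun S => (closedSievesEquiv q S).1) hx).trans (Set.ext fun r => ?_)
    exact ⟨fun ⟨f, hf⟩ => ⟨⟨f ≫ homOfLE h, hf⟩, leOfHom f⟩, fun ⟨⟨f, hf⟩, hr⟩ => ⟨homOfLE hr, hf⟩⟩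
  · intro p z
    have hz := congrArg (fun α => α.app (op p) z) (hnat (Sheaf.truth J))
    refine (congrArg (fun S => (closedSievesEquiv p S).1) hz).trans (Set.ext fun r => ?_)
    exact ⟨fun ⟨f, _⟩ => leOfHom f, fun h => ⟨homOfLE h, trivial⟩⟩

theorem mainTheorem1 (T : Type u) [Order.Frame T] :
    ∃ _ : IsElementaryTopos (TSet T),
      (∃ c : Subobject.Classifier (TSet T),
        IsDownSetClassifier c ∧ Nonempty (PowerFunctor c.Ω)) ∧
      ∃ e : TSet T ≌ Sheaf (territoryTopology T) (Type u),
        Nonempty (e.functor ⋙ sheafToPresheaf (territoryTopology T) (Type u) ≅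
          TSet.presheafFunctor T) :=
  ⟨.of_equivalence_sheaf _ (TSet.sheafEquivalence T),
    ⟨_, TSet.isDownSetClassifier_ofEquivalence T, @IsElementaryTopos.nonempty_powerFunctor _ _
      (.of_equivalence_sheaf _ (TSet.sheafEquivalence T)) _⟩,
    -- `sheafFunctor` lifts `presheafFunctor`, so forgetting the sheaf condition returns it
    -- definitionally.
    TSet.sheafEquivalence T, ⟨Iso.refl _⟩⟩
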